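/- Let $\mathcal M$ be a Markov automaton with a finite state set $S$ and a finite set of actions. Its probabilistic transitions $s\xrightarrow{\alpha}\mu$ are all internal and numbered, so that a state $s$ and an enabled action $\alpha\in\mathit{Act}(s)$ determine the distribution $\mu^s_\alpha$ on $S$. Its Markovian transitions $s\overset{\lambda}{\Rightarrow}s'$ have rates $\lambda>0$ and finite total rates $\mathbf R(s,s')=\sum\{\lambda\mid s\overset{\lambda}{\Rightarrow}s'\}$; put $E(s)=\sum_{s'}\mathbf R(s,s')$ and $\mathbf P(s,s')=\mathbf R(s,s')/E(s)$. Every state has an outgoing transition. By maximal progress $S$ is partitioned into the set $\mathit{PS}$ of states with a probabilistic transition and the set $\mathit{MS}$ of the remaining states. The residence time is $0$ in a probabilistic state and exponential with rate $E(s)$ in $s\in\mathit{MS}$, which is left for $s'$ with probability $\mathbf P(s,s')$. Let $\mathcal I$ be the set of nonempty intervals of nonnegative reals with real bounds (open, closed or half-open), and for $I\in\mathcal I$, $t\ge 0$ let $I\ominus t=\{x-t\mid x\in I,\ x\ge t\}$. For $G\subseteq S$ let $\diamondsuit^I G$ be the set of infinite paths that occupy some state of $G$ at some time in $I$, and let $p_{\max}(s,\diamondsuit^I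 G)=\sup_D \Pr_{s,D}(\diamondsuit^I G)$, where $D$ ranges over all generic measurable policies (measurable, randomised, depending on the whole finite path with its residence times). Then $(s,I)\mapsto p_{\max}(s,\diamondsuit^I G)$ is the least fixpoint (for the pointwise order) of the operator $\Omega\colon(S\times\mathcal I\to[0,1])\to(S\times\mathcal I\to[0,1])$ that is given, with $a=\inf I$ and $b=\sup I$, for $s\in\mathit{MS}$ by $$\Omega(F)(s,I)=\begin{cases}\displaystyle\int_0^b E(s)e^{-E(s)t}\sum_{s'\in S}\mathbf P(s,s')F(s',I\ominus t)\,dt & s\notin G,\\[1ex] \displaystyle e^{-E(s)a}+\int_0^a E(s)e^{-E(s)t}\sum_{s'\in S}\mathbf P(s,s')F(s',I\ominus t)\,dt & s\in G,\end{cases}$$ and for $s\in\mathit{PS}$ by $$\Omega(F)(s,I)=\begin{cases}1 & s\in G\text{ and }0\in I,\\ \displaystyle\max_{\alpha\in\mathit{Act}(s)}\sum_{s'\in S}\mu^s_\alpha(s')F(s',I) & \text{otherwise.}\end{cases}$$ Here the integrals are lower integrals when $F(s',I\ominus t)$ is not measurable in $t$, and $F(s',I\ominus t)$ is read as $0$ where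 $I\ominus t=\emptyset$ (at most one $t\in[0,b]$). The function $p_{\max}(s,\diamondsuit^{I\ominus t}G)$ is measurable in $t$. -/

import Mathlib

open MeasureTheory ProbabilityTheory Set
open scoped ENNReal NNReal

noncomputable section

/-! ### Markov automata -/

/-- A (closed) Markov automaton with state space `S` and action set `A`.  All actions are internal,
and they are numbered, so that an action enabled in a state determines the successor distribution.
The total rate between any two states is finite, and every state has an outgoing transition. -/
structure MarkovAutomaton (S A : Type*) where
  /-- the probabilistic transitions `s -α→ μ` -/
  prob : S → A → PMF S → Prop
  /-- the Markovian transitions from `s` to `s'` with rate `r` -/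
  markov : S → ℝ → S → Prop
  /-- the initial state -/
  init : S
  prob_unique : ∀ {s α μ ν}, prob s α μ → prob s α ν → μ = ν
  rate_pos : ∀ {s r s'}, markov s r s' → 0 < r
  summable_rates : ∀ s s', Summable fun r : {r // markov s r s'} => r.1
  exists_transition : ∀ s, (∃ α μ, prob s α μ) ∨ ∃ r s', markov s r s'

/-- The label of a step: an action, or the symbol `⊥` of a Markovian step. -/
inductive Label (A : Type*) where
  | act (α : A) : Label A
  | bot : Label A

namespace Label

variable {A : Type*}

/-- Labels carry the discrete σ-algebra. -/
instance : MeasurableSpace (Label A) := ⊤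

instance : DiscreteMeasurableSpace (Label A) := ⟨fun _ => trivial⟩

instance [Finite A] : Finite (Label A) :=
  Finite.of_surjective (fun o : Option A => o.elim Label.bot Label.act) (by
    rintro (α | _)
    · exact ⟨some α, rfl⟩
    · exact ⟨none, rfl⟩)

end Label

/-- One entry of a path: `(σ, t, s)` means that the state `s` is entered by a step labelled `σ`,
after a residence time `t` in the preceding state. -/
abbrev Entry (S A : Type*) := Label A × ℝ≥0 × S

/-- An infinite path `s₀ -σ₀,t₀→ s₁ -σ₁,t₁→ …` is the sequence of entries
`(⊥, 0, s₀), (σ₀, t₀, s₁), (σ₁, t₁, s₂), …`; the labels and times of the first entry are dummies. -/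
abbrev MAPath (S A : Type*) := ℕ → Entry S A

/-- A finite path with `n` steps, encoded in the same way. -/
abbrev FinPath (S A : Type*) (n : ℕ) := Finset.Iic n → Entry S A

/-- The last state of a finite path. -/
def FinPath.last {S A : Type*} {n : ℕ} (h : FinPath S A n) : S :=
  (h ⟨n, Finset.mem_Iic.2 le_rfl⟩).2.2

namespace MarkovAutomaton

variable {S A : Type*}

/-- The set `Act(s)` of actions enabled in `s`. -/
def Act (M : MarkovAutomaton S A) (s : S) : Set A := {α | ∃ μ, M.prob s α μ}

/-- The probabilistic states. -/
def PS (M : MarkovAutomaton S A) : Set S := {s | (M.Act s).Nonempty}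

/-- The Markovian states.  By maximal progress, a Markovian transition out of a state that also has
an (internal) probabilistic transition never fires. -/
def MS (M : MarkovAutomaton S A) : Set S := M.PSᶜ

open Classical in
/-- The distribution `μ^s_α` (a dummy value if `α` is not enabled in `s`). -/
def dist (M : MarkovAutomaton S A) (s : S) (α : A) : PMF S :=
  if h : ∃ μ, M.prob s α μ then h.choose else PMF.pure s

/-- The total rate `R(s, s')`. -/
def R (M : MarkovAutomaton S A) (s s' : S) : ℝ := ∑' r : {r // M.markov s r s'}, r.1

/-- The exit rate `E(s)`. -/
def E [Fintype S] (M : MarkovAutomaton S A) (s : S) : ℝ := ∑ s', M.R s s'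

/-- The branching probability `P(s, s') = R(s, s') / E(s)`. -/
def P [Fintype S] (M : MarkovAutomaton S A) (s s' : S) : ℝ := M.R s s' / M.E s

theorem R_nonneg (M : MarkovAutomaton S A) (s s' : S) : 0 ≤ M.R s s' :=
  tsum_nonneg fun r => (M.rate_pos r.2).le

theorem E_nonneg [Fintype S] (M : MarkovAutomaton S A) (s : S) : 0 ≤ M.E s :=
  Finset.sum_nonneg fun s' _ => M.R_nonneg s s'

theorem E_pos [Fintype S] (M : MarkovAutomaton S A) {s : S} (hs : s ∈ M.MS) : 0 < M.E s := by
  rcases M.exists_transition s with ⟨α, μ, h⟩ | ⟨r, s', h⟩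
  · exact absurd ⟨α, μ, h⟩ hs
  · have h1 : r ≤ M.R s s' :=
      (M.summable_rates s s').le_tsum ⟨r, h⟩ fun x _ => (M.rate_pos x.2).le
    have h2 : M.R s s' ≤ M.E s :=
      Finset.single_le_sum (f := fun x => M.R s x) (fun x _ => M.R_nonneg s x)
        (Finset.mem_univ s')
    linarith [M.rate_pos h]

theorem P_nonneg [Fintype S] (M : MarkovAutomaton S A) (s s' : S) : 0 ≤ M.P s s' :=
  div_nonneg (M.R_nonneg s s') (M.E_nonneg s)

theorem sum_P [Fintype S] (M : MarkovAutomaton S A) {s : S} (hs : s ∈ M.MS) :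
    ∑ s', ENNReal.ofReal (M.P s s') = 1 := by
  rw [← ENNReal.ofReal_sum_of_nonneg fun s' _ => M.P_nonneg s s']
  have : ∑ s', M.P s s' = 1 := by
    simp only [P, ← Finset.sum_div]
    exact div_self (M.E_pos hs).ne'
  simp [this]

/-! ### Policies and the induced probability measure on paths -/

/-- The label `σ` is available in the state `s`. -/
def Enabled (M : MarkovAutomaton S A) (s : S) : Label A → Prop
  | .act α => α ∈ M.Act s
  | .bot => s ∈ M.MS

/-- A generic measurable (history-dependent, time-dependent, randomised) policy: it maps every
finite path, measurably, to a distribution on the labels that are available in its last state. -/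
structure Policy [MeasurableSpace S] (M : MarkovAutomaton S A) where
  choice : (n : ℕ) → Kernel (FinPath S A n) (Label A)
  isMarkov : ∀ n, IsMarkovKernel (choice n)
  enabled : ∀ n (h : FinPath S A n) (σ : Label A), choice n h {σ} ≠ 0 → M.Enabled h.last σ

open Classical in
/-- The distribution of the next state: `μ^s_α` for the label `α`, and `P(s, ·)` for the
label `⊥` (with a dummy value in probabilistic states, where `⊥` is not available). -/
def next [Fintype S] (M : MarkovAutomaton S A) (s : S) : Label A → PMF S
  | .act α => M.dist s α
  | .bot =>
    if hs : s ∈ M.MS then PMF.ofFintype (fun s' => ENNReal.ofReal (M.P s s')) (M.sum_P hs)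
    else PMF.pure s

open Classical in
/-- The distribution of the residence time in `s`: exponential with rate `E(s)` in Markovian
states, and zero in probabilistic states. -/
def sojourn [Fintype S] (M : MarkovAutomaton S A) (s : S) : Measure ℝ≥0 :=
  if s ∈ M.MS then (expMeasure (M.E s)).map Real.toNNReal else Measure.dirac 0

instance [Fintype S] (M : MarkovAutomaton S A) (s : S) : IsProbabilityMeasure (M.sojourn s) := by
  unfold sojourn
  split_ifs with h
  · have := isProbabilityMeasure_expMeasure (M.E_pos h)
    exact Measure.isProbabilityMeasure_map measurable_real_toNNReal.aemeasurable
  · infer_instance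

theorem measurable_last_label [MeasurableSpace S] (n : ℕ) :
    Measurable fun x : FinPath S A n × Label A => (x.1.last, x.2) := by
  unfold FinPath.last
  fun_prop

section Measure

variable [Fintype S] [MeasurableSpace S] [MeasurableSingletonClass S] [Finite A]

/-- The law of (residence time, next state), given the current state and the chosen label. -/
def stepLaw (M : MarkovAutomaton S A) : Kernel (S × Label A) (ℝ≥0 × S) :=
  Kernel.ofFunOfCountable fun x => (M.sojourn x.1).prod (M.next x.1 x.2).toMeasure

instance (M : MarkovAutomaton S A) : IsMarkovKernel M.stepLaw :=
  ⟨fun x => inferInstanceAs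
    (IsProbabilityMeasure ((M.sojourn x.1).prod (M.next x.1 x.2).toMeasure))⟩

/-- The law of the next entry of a path, given the finite path so far, under the policy `D`: the
policy draws a label, and then the residence time and the next state are drawn. -/
def step (M : MarkovAutomaton S A) (D : M.Policy) (n : ℕ) : Kernel (FinPath S A n) (Entry S A) :=
  D.choice n ⊗ₖ M.stepLaw.comap (fun x => (x.1.last, x.2)) (measurable_last_label n)

instance (M : MarkovAutomaton S A) (D : M.Policy) (n : ℕ) : IsMarkovKernel (M.step D n) := by
  have := D.isMarkov n
  unfold step
  infer_instance

/-- The probability measure `Pr_{s,D}` on infinite paths (by the Ionescu-Tulcea theorem). -/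
def Pr (M : MarkovAutomaton S A) (D : M.Policy) (s : S) : Measure (MAPath S A) :=
  Kernel.traj (X := fun _ => Entry S A) (fun n => M.step D n) 0 (fun _ => (Label.bot, 0, s))

end Measure

end MarkovAutomaton

/-! ### Timed reachability -/

/-- The time at which the `n`-th state (counted from zero) of the path is entered. -/
def MAPath.time {S A : Type*} (π : MAPath S A) (n : ℕ) : ℝ :=
  ∑ i ∈ Finset.range n, ((π (i + 1)).2.1 : ℝ)

/-- The set of the states that the path `π` occupies at time `t`.  At a jump it occupies both the
state that it leaves and the one that it enters. -/
def MAPath.at {S A : Type*} (π : MAPath S A) (t : ℝ) : Set S :=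
  {s | ∃ n, (π n).2.2 = s ∧ π.time n ≤ t ∧ t ≤ π.time (n + 1)}

/-- The paths that visit some state of `G` within `I`. -/
def reach {S : Type*} (A : Type*) (G : Set S) (I : Set ℝ) : Set (MAPath S A) :=
  {π | ∃ t ∈ I, (G ∩ π.at t).Nonempty}

/-- The nonempty intervals of nonnegative reals with real bounds (open, closed or half-open). -/
structure TInterval where
  carrier : Set ℝ
  nonempty : carrier.Nonempty
  ordConnected : carrier.OrdConnected
  bddAbove : BddAbove carrier
  nonneg : ∀ x ∈ carrier, 0 ≤ x

/-- `I ⊖ t`, as a set. -/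
def ominus (I : Set ℝ) (t : ℝ) : Set ℝ := {y | ∃ x ∈ I, t ≤ x ∧ y = x - t}

/-- `I ⊖ t`, as an interval, when it is nonempty. -/
def TInterval.shift (I : TInterval) (t : ℝ) (h : (ominus I.carrier t).Nonempty) : TInterval where
  carrier := ominus I.carrier t
  nonempty := h
  ordConnected := by
    refine ⟨?_⟩
    rintro _ ⟨x, hx, htx, rfl⟩ _ ⟨y, hy, hty, rfl⟩ z ⟨h1, h2⟩
    exact ⟨z + t, I.ordConnected.out hx hy ⟨by linarith, by linarith⟩, by linarith, by ring⟩
  bddAbove := by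
    obtain ⟨B, hB⟩ := I.bddAbove
    refine ⟨B - t, ?_⟩
    rintro _ ⟨x, hx, -, rfl⟩
    linarith [hB hx]
  nonneg := by
    rintro _ ⟨x, -, htx, rfl⟩
    linarith

/-- The unit interval `[0,1]`, inside the extended nonnegative reals. -/
abbrev UnitI := Set.Icc (0 : ℝ≥0∞) 1

namespace MarkovAutomaton

variable {S A : Type*}

open Classical in
/-- `F(s, I ⊖ t)`.  It is set to `0` where `I ⊖ t` is empty; for `t` between `0` and `sup I` that
happens for at most one `t`, so this does not affect the integrals below. -/
def shifted (F : S × TInterval → UnitI) (s : S) (I : TInterval) (t : ℝ) : ℝ≥0∞ :=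
  if h : (ominus I.carrier t).Nonempty then (F (s, I.shift t h)).1 else 0

theorem shifted_le_one (F : S × TInterval → UnitI) (s : S) (I : TInterval) (t : ℝ) :
    shifted F s I t ≤ 1 := by
  unfold shifted
  split_ifs
  · exact (F _).2.2
  · exact zero_le

variable [Fintype S]

/-- `∫₀ᶜ E(s) e^{-E(s)t} ∑_{s'} P(s,s') F(s', I ⊖ t) dt`. -/
def flow (M : MarkovAutomaton S A) (F : S × TInterval → UnitI) (s : S) (I : TInterval) (c : ℝ) :
    ℝ≥0∞ :=
  ∫⁻ t in Set.Icc 0 c, ENNReal.ofReal (M.E s * Real.exp (-(M.E s * t))) *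
    ∑ s', ENNReal.ofReal (M.P s s') * shifted F s' I t

open Classical in
/-- The right-hand side of the fixpoint equation. The supremum over the finite, nonempty set of
enabled actions is a maximum. -/
def OmegaFun (M : MarkovAutomaton S A) (G : Set S) (F : S × TInterval → UnitI)
    (s : S) (I : TInterval) : ℝ≥0∞ :=
  if s ∈ M.MS then
    if s ∈ G then
      ENNReal.ofReal (Real.exp (-(M.E s * sInf I.carrier))) + M.flow F s I (sInf I.carrier)
    else M.flow F s I (sSup I.carrier)
  else
    if s ∈ G ∧ 0 ∈ I.carrier then 1
    else ⨆ α ∈ M.Act s, ∑ s', M.dist s α s' * (F (s', I)).1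

theorem flow_le (M : MarkovAutomaton S A) (F : S × TInterval → UnitI) {s : S} (hs : s ∈ M.MS)
    (I : TInterval) {c : ℝ} (hc : 0 ≤ c) :
    M.flow F s I c ≤ ENNReal.ofReal (1 - Real.exp (-(M.E s * c))) := by
  calc M.flow F s I c
      ≤ ∫⁻ t in Set.Icc 0 c, exponentialPDF (M.E s) t := by
        refine setLIntegral_mono_ae (by
          unfold exponentialPDF
          exact (measurable_exponentialPDFReal _).ennreal_ofReal.aemeasurable) ?_
        refine Filter.Eventually.of_forall fun t ht => ?_
        rw [exponentialPDF_of_nonneg ht.1]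
        refine mul_le_of_le_one_right zero_le ?_
        rw [← M.sum_P hs]
        exact Finset.sum_le_sum fun s' _ =>
          mul_le_of_le_one_right zero_le (shifted_le_one F s' I t)
    _ ≤ ∫⁻ t in Set.Iic c, exponentialPDF (M.E s) t :=
        lintegral_mono_set Set.Icc_subset_Iic_self
    _ = _ := by rw [lintegral_exponentialPDF_eq_antiDeriv (M.E_pos hs), if_pos hc]

theorem OmegaFun_le_one (M : MarkovAutomaton S A) (G : Set S) (F : S × TInterval → UnitI)
    (s : S) (I : TInterval) : M.OmegaFun G F s I ≤ 1 := by
  have ha : 0 ≤ sInf I.carrier := Real.sInf_nonneg I.nonneg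
  have hb : 0 ≤ sSup I.carrier := Real.sSup_nonneg I.nonneg
  unfold OmegaFun
  split_ifs with h1 h2 h3
  · refine (add_le_add le_rfl (M.flow_le F h1 I ha)).trans ?_
    have : Real.exp (-(M.E s * sInf I.carrier)) ≤ 1 :=
      Real.exp_le_one_iff.2 (neg_nonpos.2 (mul_nonneg (M.E_nonneg s) ha))
    rw [← ENNReal.ofReal_add (Real.exp_pos _).le (by linarith)]
    simp
  · refine (M.flow_le F h1 I hb).trans ?_
    rw [ENNReal.ofReal_le_one]
    linarith [Real.exp_pos (-(M.E s * sSup I.carrier))]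
  · exact le_rfl
  · refine iSup₂_le fun α _ => ?_
    calc ∑ s', M.dist s α s' * (F (s', I)).1 ≤ ∑ s', M.dist s α s' :=
          Finset.sum_le_sum fun s' _ => mul_le_of_le_one_right zero_le (F _).2.2
      _ = 1 := by rw [← PMF.tsum_coe (M.dist s α), tsum_fintype]

/-- The higher-order operator `Ω : (S × ℐ → [0,1]) → (S × ℐ → [0,1])`. -/
def Omega (M : MarkovAutomaton S A) (G : Set S) (F : S × TInterval → UnitI) :
    S × TInterval → UnitI :=
  fun x => ⟨M.OmegaFun G F x.1 x.2, zero_le, M.OmegaFun_le_one G F x.1 x.2⟩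

/-- The maximal probability `p_max(s, ◇^I G)`, over all generic measurable policies. -/
def pmax [MeasurableSpace S] [MeasurableSingletonClass S] [Finite A]
    (M : MarkovAutomaton S A) (G : Set S) : S × TInterval → UnitI :=
  fun x => ⟨⨆ D : M.Policy, M.Pr D x.1 (reach A G x.2.carrier), zero_le,
    iSup_le fun D => by unfold Pr; exact prob_le_one⟩

end MarkovAutomaton

end

/-! ### Intervals and shifts -/

/-! This is value iteration: with f₀ = 0 and f_{n+1} = Ω(f_n), the value f_n(s, I) is the largest
probability of visiting G within I by one of the first n states, and `pmax` is the supremum of the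
f_n (`pmax_eq_iSup_iter`).

The interval I is kept fixed and the clock runs instead. At elapsed time t the value that remains is
f_n(s, I ⊖ t), and `shifted_Omega` shows that Ω then takes the best expected gain of a single step
over the enabled labels: gain 1 if the residence in s ∈ G meets I, otherwise the value at the next
state and time. Conditioning the path law on one more step gives the same recursion, except that the
policy averages over labels. An average is at most the maximum, so f_n bounds every policy
(`condLaw_reachBetween_le`). Conversely, there are finitely many labels and the step values are
measurable in t, so a maximising label can be chosen measurably; this gives a policy that attains
f_n (`exists_policy_eq_iter`).

Monotone convergence makes Ω commute with the supremum of the measurable f_n (`OmegaFun_iSup`), so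
`pmax` is a fixpoint. Monotonicity of Ω puts every f_n below any fixpoint (`iter_le`), so it is the
least one. -/

theorem TInterval.ext' {I J : TInterval} (h : I.carrier = J.carrier) : I = J := by
  cases I; cases J; cases h; rfl

/-- The interval `[c, d]` meets `I`. -/
def Touches (I : Set ℝ) (c d : ℝ) : Prop := ∃ x ∈ I, c ≤ x ∧ x ≤ d

/-- If x ≥ c and y ≤ d are points of I and neither lies in [c, d], then y < c ≤ d < x, so c itself
is in I. The condition thus splits into one on c and one on d, each cutting out a ray, which yields
measurability. -/
theorem touches_iff {I : Set ℝ} (hI : I.OrdConnected) {c d : ℝ} (h : c ≤ d) :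
    Touches I c d ↔ c ∈ {c | ∃ x ∈ I, c ≤ x} ∧ d ∈ {d | ∃ x ∈ I, x ≤ d} := by
  constructor
  · rintro ⟨x, hx, h1, h2⟩
    exact ⟨⟨x, hx, h1⟩, ⟨x, hx, h2⟩⟩
  · rintro ⟨⟨x, hx, h1⟩, ⟨y, hy, h2⟩⟩
    rcases le_total x d with h3 | h3
    · exact ⟨x, hx, h1, h3⟩
    · rcases le_total c y with h4 | h4
      · exact ⟨y, hy, h4, h2⟩
      · exact ⟨c, hI.out hy hx ⟨h4, h1⟩, le_rfl, h⟩

theorem measurableSet_touches {X : Type*} [MeasurableSpace X] {I : Set ℝ} (hI : I.OrdConnected)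
    {c d : X → ℝ} (hc : Measurable c) (hd : Measurable d) (h : ∀ x, c x ≤ d x) :
    MeasurableSet {x | Touches I (c x) (d x)} := by
  have : {x | Touches I (c x) (d x)} =
      c ⁻¹' {c | ∃ x ∈ I, c ≤ x} ∩ d ⁻¹' {d | ∃ x ∈ I, x ≤ d} := by
    ext x
    exact touches_iff hI (h x)
  rw [this]
  have hL : IsLowerSet {c : ℝ | ∃ x ∈ I, c ≤ x} := fun _ _ hab ⟨x, hx, h⟩ => ⟨x, hx, hab.trans h⟩
  have hU : IsUpperSet {c : ℝ | ∃ x ∈ I, x ≤ c} := fun _ _ hab ⟨x, hx, h⟩ => ⟨x, hx, h.trans hab⟩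
  exact (hc hL.ordConnected.measurableSet).inter (hd hU.ordConnected.measurableSet)

theorem ominus_ominus (I : Set ℝ) (t : ℝ) {u : ℝ} (hu : 0 ≤ u) :
    ominus (ominus I t) u = ominus I (t + u) := by
  ext y
  constructor
  · rintro ⟨_, ⟨x, hx, h1, rfl⟩, h2, rfl⟩
    exact ⟨x, hx, by linarith, by ring⟩
  · rintro ⟨x, hx, h1, rfl⟩
    exact ⟨x - t, ⟨x, hx, by linarith, rfl⟩, by linarith, by ring⟩

theorem ominus_zero (I : TInterval) : ominus I.carrier 0 = I.carrier := by
  ext y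
  constructor
  · rintro ⟨x, hx, -, rfl⟩
    simpa using hx
  · intro h
    exact ⟨y, h, I.nonneg y h, by ring⟩

theorem touches_ominus (I : Set ℝ) (t u : ℝ) :
    Touches (ominus I t) 0 u ↔ Touches I t (t + u) := by
  constructor
  · rintro ⟨_, ⟨x, hx, h, rfl⟩, -, h2⟩
    exact ⟨x, hx, h, by linarith⟩
  · rintro ⟨x, hx, h1, h2⟩
    exact ⟨x - t, ⟨x, hx, h1, rfl⟩, by linarith, by linarith⟩

theorem touches_of_sInf_lt (I : TInterval) {u : ℝ} (hu : sInf I.carrier < u) :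
    Touches I.carrier 0 u := by
  obtain ⟨x, hx, h⟩ := exists_lt_of_csInf_lt I.nonempty hu
  exact ⟨x, hx, I.nonneg x hx, h.le⟩

theorem not_touches_of_lt_sInf (I : TInterval) {u : ℝ} (hu : u < sInf I.carrier) :
    ¬ Touches I.carrier 0 u := by
  rintro ⟨x, hx, -, h⟩
  exact (hu.trans_le (csInf_le ⟨0, I.nonneg⟩ hx)).not_ge h

theorem ominus_eq_empty_of_sSup_lt (I : TInterval) {u : ℝ} (hu : sSup I.carrier < u) :
    ¬ (ominus I.carrier u).Nonempty := by
  rintro ⟨_, x, hx, h, rfl⟩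
  exact (hu.trans_le h).not_ge (le_csSup I.bddAbove hx)

/-- A measurable maximiser of finitely many measurable functions. -/
theorem exists_measurable_argmax {X B : Type*} [MeasurableSpace X] [MeasurableSpace B]
    [Countable B] [DiscreteMeasurableSpace B] (f : B → X → ℝ≥0∞) (hf : ∀ b, Measurable (f b))
    (s : Finset B) (hs : s.Nonempty) :
    ∃ g : X → B, Measurable g ∧ ∀ x, g x ∈ s ∧ ∀ b ∈ s, f b x ≤ f (g x) x := by
  classical
  induction hs using Finset.Nonempty.cons_induction with
  | singleton a => exact ⟨fun _ => a, measurable_const, by simp⟩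
  | cons a s ha hs ih =>
    obtain ⟨g, hg, h⟩ := ih
    have hfg : Measurable fun x => f (g x) x :=
      (measurable_from_prod_countable_right (f := fun p : B × X => f p.1 p.2) hf).comp
        (hg.prodMk measurable_id)
    refine ⟨fun x => if f (g x) x ≤ f a x then a else g x,
      Measurable.ite (measurableSet_le hfg (hf a)) measurable_const hg, fun x => ?_⟩
    have := h x
    dsimp only
    split_ifs with hx
    · refine ⟨by simp, fun b hb => ?_⟩
      rcases Finset.mem_cons.1 hb with rfl | hb
      · exact le_rfl
      · exact (this.2 b hb).trans hx
    · refine ⟨by simp [this.1], fun b hb => ?_⟩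
      rcases Finset.mem_cons.1 hb with rfl | hb
      · exact (not_le.1 hx).le
      · exact this.2 b hb

/-! ### Shifted values and the expected gain of one step -/

namespace MarkovAutomaton

variable {S A : Type*}

theorem shifted_shift (F : S × TInterval → UnitI) (s : S) (I : TInterval) (t : ℝ)
    (h : (ominus I.carrier t).Nonempty) {u : ℝ} (hu : 0 ≤ u) :
    shifted F s (I.shift t h) u = shifted F s I (t + u) := by
  have e : ominus (I.shift t h).carrier u = ominus I.carrier (t + u) :=
    ominus_ominus I.carrier t hu
  unfold shifted
  by_cases hn : (ominus I.carrier (t + u)).Nonempty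
  · have hn' : (ominus (I.shift t h).carrier u).Nonempty := by rwa [e]
    rw [dif_pos hn, dif_pos hn']
    congr 3
    exact TInterval.ext' e
  · have hn' : ¬ (ominus (I.shift t h).carrier u).Nonempty := by rwa [e]
    rw [dif_neg hn, dif_neg hn']

theorem shifted_zero (F : S × TInterval → UnitI) (s : S) (I : TInterval) :
    shifted F s I 0 = (F (s, I)).1 := by
  have hn : (ominus I.carrier 0).Nonempty := by rw [ominus_zero]; exact I.nonempty
  unfold shifted
  rw [dif_pos hn]
  congr 3
  exact TInterval.ext' (ominus_zero I)

theorem shifted_of_empty (F : S × TInterval → UnitI) (s : S) (I : TInterval) {t : ℝ}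
    (h : ¬ (ominus I.carrier t).Nonempty) : shifted F s I t = 0 := by
  unfold shifted
  rw [dif_neg h]

theorem shifted_mono {F F' : S × TInterval → UnitI} (h : F ≤ F') (s : S) (I : TInterval) (t : ℝ) :
    shifted F s I t ≤ shifted F' s I t := by
  unfold shifted
  split_ifs
  · exact h _
  · exact le_rfl

open Classical in
/-- The gain of a step out of `s` at time `t` that visits `G` within `I` before the step, or
otherwise continues with the value `W`. -/
noncomputable def stepGain (G : Set S) (I : Set ℝ) (W : S → ℝ → ℝ≥0∞) (s : S)
    (t : ℝ) (p : ℝ≥0 × S) : ℝ≥0∞ :=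
  if s ∈ G ∧ Touches I t (t + p.1) then 1 else W p.2 (t + p.1)

theorem stepGain_of_touches {G : Set S} {I : Set ℝ} {s : S} {t : ℝ} {p : ℝ≥0 × S}
    (h : s ∈ G ∧ Touches I t (t + p.1)) (W : S → ℝ → ℝ≥0∞) : stepGain G I W s t p = 1 :=
  if_pos h

theorem stepGain_of_not_touches {G : Set S} {I : Set ℝ} {s : S} {t : ℝ} {p : ℝ≥0 × S}
    (h : ¬ (s ∈ G ∧ Touches I t (t + p.1))) (W : S → ℝ → ℝ≥0∞) :
    stepGain G I W s t p = W p.2 (t + p.1) :=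
  if_neg h

section

variable [Fintype S]

theorem flow_mono (M : MarkovAutomaton S A) {F F' : S × TInterval → UnitI} (h : F ≤ F') (s : S)
    (I : TInterval) (c : ℝ) : M.flow F s I c ≤ M.flow F' s I c := by
  unfold flow
  gcongr with t s'
  exact shifted_mono h _ _ _

theorem Omega_mono (M : MarkovAutomaton S A) (G : Set S) : Monotone (M.Omega G) := by
  intro F F' h x
  change M.OmegaFun G F x.1 x.2 ≤ M.OmegaFun G F' x.1 x.2
  unfold OmegaFun
  have (s' : S) : (F (s', x.2)).1 ≤ (F' (s', x.2)).1 := h _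
  split_ifs
  · gcongr
    exact flow_mono M h _ _ _
  · exact flow_mono M h _ _ _
  · exact le_rfl
  · gcongr
    apply this

variable [MeasurableSpace S] [MeasurableSingletonClass S]

theorem measurable_stepGain {X : Type*} [MeasurableSpace X] {G : Set S} {I : Set ℝ}
    (hI : I.OrdConnected) {W : S → ℝ → ℝ≥0∞} (hW : ∀ s, Measurable (W s))
    {s : X → S} {t : X → ℝ} {p : X → ℝ≥0 × S} (hs : Measurable s) (ht : Measurable t)
    (hp : Measurable p) : Measurable fun x => stepGain G I W (s x) (t x) (p x) := by
  unfold stepGain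
  have h1 : Measurable fun x => t x + ((p x).1 : ℝ) := by fun_prop
  refine Measurable.ite ((hs (MeasurableSet.of_discrete (s := G))).inter
    (measurableSet_touches hI ht h1 fun x => by simp)) measurable_const ?_
  exact (measurable_from_prod_countable_right (f := fun q : S × ℝ => W q.1 q.2) hW).comp
    (hp.snd.prodMk h1)

variable [Finite A]

/-- The expected gain of a step with label `σ` out of `s` at time `t`. -/
noncomputable def stepValue (M : MarkovAutomaton S A) (G : Set S) (I : Set ℝ) (W : S → ℝ → ℝ≥0∞)
    (s : S) (t : ℝ) (σ : Label A) : ℝ≥0∞ :=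
  ∫⁻ p, stepGain G I W s t p ∂M.stepLaw (s, σ)

theorem measurable_stepValue (M : MarkovAutomaton S A) (G : Set S) {I : Set ℝ}
    (hI : I.OrdConnected) {W : S → ℝ → ℝ≥0∞} (hW : ∀ s, Measurable (W s)) (s : S) (σ : Label A) :
    Measurable fun t => M.stepValue G I W s t σ := by
  unfold stepValue
  exact Measurable.lintegral_prod_right' (f := fun x : ℝ × (ℝ≥0 × S) => stepGain G I W s x.1 x.2)
    (measurable_stepGain hI hW measurable_const measurable_fst measurable_snd)

theorem stepValue_eq_sum (M : MarkovAutomaton S A) (G : Set S) {I : Set ℝ}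
    (hI : I.OrdConnected) {W : S → ℝ → ℝ≥0∞} (hW : ∀ s, Measurable (W s)) (s : S) (t : ℝ)
    (σ : Label A) :
    M.stepValue G I W s t σ =
      ∫⁻ u, ∑ s', M.next s σ s' * stepGain G I W s t (u, s') ∂M.sojourn s := by
  have hm : Measurable fun p => stepGain G I W s t p :=
    measurable_stepGain hI hW measurable_const measurable_const measurable_id
  change ∫⁻ p, stepGain G I W s t p ∂((M.sojourn s).prod (M.next s σ).toMeasure) = _
  rw [lintegral_prod _ hm.aemeasurable]
  refine lintegral_congr fun u => ?_
  rw [lintegral_fintype]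
  refine Finset.sum_congr rfl fun s' _ => ?_
  rw [PMF.toMeasure_apply_singleton _ _ (measurableSet_singleton _), mul_comm]

end

end MarkovAutomaton

/-! ### Integrals against the exponential law -/

theorem lintegral_expMeasure {r : ℝ} {f : ℝ → ℝ≥0∞} (hf : Measurable f) :
    ∫⁻ u, f u ∂expMeasure r =
      ∫⁻ u in Ici 0, ENNReal.ofReal (r * Real.exp (-(r * u))) * f u := by
  have hm : Measurable (exponentialPDF r) := by
    unfold exponentialPDF
    exact (measurable_exponentialPDFReal _).ennreal_ofReal
  change ∫⁻ u, f u ∂(volume.withDensity (exponentialPDF r)) = _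
  rw [lintegral_withDensity_eq_lintegral_mul _ hm hf, ← lintegral_indicator measurableSet_Ici]
  refine lintegral_congr fun u => ?_
  by_cases hu : 0 ≤ u
  · rw [indicator_of_mem (show u ∈ Ici 0 from hu), Pi.mul_apply, exponentialPDF_of_nonneg hu]
  · rw [indicator_of_notMem (show u ∉ Ici 0 from hu), Pi.mul_apply,
      exponentialPDF_of_neg (not_le.1 hu), zero_mul]

theorem lintegral_Ioi_exp {r : ℝ} (hr : 0 < r) {a : ℝ} (ha : 0 ≤ a) :
    ∫⁻ u in Ioi a, ENNReal.ofReal (r * Real.exp (-(r * u))) =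
      ENNReal.ofReal (Real.exp (-(r * a))) := by
  have := isProbabilityMeasure_expMeasure hr
  have h1 : ∫⁻ u in Ioi a, ENNReal.ofReal (r * Real.exp (-(r * u))) = expMeasure r (Ioi a) := by
    change _ = (volume.withDensity (exponentialPDF r)) (Ioi a)
    rw [withDensity_apply _ measurableSet_Ioi]
    refine setLIntegral_congr_fun measurableSet_Ioi fun u hu => ?_
    rw [exponentialPDF_of_nonneg (ha.trans (le_of_lt hu))]
  have h2 : expMeasure r (Iic a) = ENNReal.ofReal (1 - Real.exp (-(r * a))) := by
    change (volume.withDensity (exponentialPDF r)) (Iic a) = _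
    rw [withDensity_apply _ measurableSet_Iic, lintegral_exponentialPDF_eq_antiDeriv hr, if_pos ha]
  rw [h1, ← compl_Iic, prob_compl_eq_one_sub measurableSet_Iic, h2, ← ENNReal.ofReal_one,
    ← ENNReal.ofReal_sub]
  · congr 1; ring
  · have : Real.exp (-(r * a)) ≤ 1 :=
      Real.exp_le_one_iff.2 (neg_nonpos.2 (mul_nonneg hr.le ha))
    linarith

/-! ### The operator Ω as an optimal one-step value -/

namespace MarkovAutomaton

variable {S A : Type*}

theorem notMem_MS_of_mem_Act (M : MarkovAutomaton S A) {s : S} {α : A} (h : α ∈ M.Act s) :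
    s ∉ M.MS :=
  fun hs => hs ⟨α, h⟩

section

variable [Fintype S]

/-- Split the residence time at a = inf I. A stay longer than a certainly meets I, and has
probability e^{-E(s)a}; a stay shorter than a ends before I begins, and the continuation decides. -/
theorem lintegral_stepGain_of_mem (M : MarkovAutomaton S A) (G : Set S)
    (F : S × TInterval → UnitI) (I : TInterval)
    {W : S → ℝ → ℝ≥0∞} (hFW : ∀ s u, 0 ≤ u → shifted F s I u = W s u) {s : S}
    (hs : s ∈ M.MS) (hG : s ∈ G) :
    ∫⁻ u in Ici 0, ENNReal.ofReal (M.E s * Real.exp (-(M.E s * u))) *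
        ∑ s', ENNReal.ofReal (M.P s s') *
          stepGain G I.carrier W s 0 (u.toNNReal, s') =
      ENNReal.ofReal (Real.exp (-(M.E s * sInf I.carrier))) + M.flow F s I (sInf I.carrier) := by
  have ha : 0 ≤ sInf I.carrier := Real.sInf_nonneg I.nonneg
  rw [← Icc_union_Ioi_eq_Ici ha, lintegral_union measurableSet_Ioi
    (disjoint_left.2 fun x h1 h2 => (lt_irrefl _ (h2.trans_le h1.2)).elim), add_comm]
  congr 1
  · rw [← lintegral_Ioi_exp (M.E_pos hs) ha]
    refine setLIntegral_congr_fun measurableSet_Ioi fun u hu => ?_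
    have hu0 : 0 ≤ u := ha.trans (le_of_lt hu)
    have : Touches I.carrier 0 (0 + u) := by
      rw [zero_add]; exact touches_of_sInf_lt I hu
    simp only [stepGain, Real.coe_toNNReal _ hu0, this, hG, and_self, if_true, mul_one, M.sum_P hs]
  · unfold flow
    -- A stay of length exactly a meets I or not according to whether a ∈ I; this single point is
    -- null.
    rw [← Measure.restrict_congr_set Ico_ae_eq_Icc]
    refine setLIntegral_congr_fun measurableSet_Ico fun u hu => ?_
    have (s' : S) : ¬ (s ∈ G ∧ Touches I.carrier 0 (0 + ((u.toNNReal, s').1 : ℝ))) := by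
      rw [zero_add, Real.coe_toNNReal _ hu.1]
      exact fun h => not_touches_of_lt_sInf I hu.2 h.2
    simp only [stepGain_of_not_touches (this _), Real.coe_toNNReal _ hu.1, zero_add, hFW _ u hu.1]

/-- Outside G only the continuation counts, and past sup I the shifted interval is empty, where the
convention `shifted` = 0 cuts the integral off. -/
theorem lintegral_stepGain_of_notMem (M : MarkovAutomaton S A) (G : Set S)
    (F : S × TInterval → UnitI) (I : TInterval)
    {W : S → ℝ → ℝ≥0∞} (hFW : ∀ s u, 0 ≤ u → shifted F s I u = W s u) {s : S} (hG : s ∉ G) :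
    ∫⁻ u in Ici 0, ENNReal.ofReal (M.E s * Real.exp (-(M.E s * u))) *
        ∑ s', ENNReal.ofReal (M.P s s') *
          stepGain G I.carrier W s 0 (u.toNNReal, s') =
      M.flow F s I (sSup I.carrier) := by
  unfold flow
  rw [← lintegral_indicator measurableSet_Ici, ← lintegral_indicator measurableSet_Icc]
  refine lintegral_congr fun u => ?_
  by_cases hu : 0 ≤ u
  · rw [indicator_of_mem (show u ∈ Ici 0 from hu)]
    simp only [stepGain, Real.coe_toNNReal _ hu, hG, false_and, if_false, zero_add, ← hFW _ u hu]
    by_cases hb : u ≤ sSup I.carrier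
    · rw [indicator_of_mem (show u ∈ Icc _ _ from ⟨hu, hb⟩)]
    · rw [indicator_of_notMem fun h => hb h.2]
      simp [shifted_of_empty F _ I (ominus_eq_empty_of_sSup_lt I (not_le.1 hb))]
  · rw [indicator_of_notMem (show u ∉ Ici 0 from hu), indicator_of_notMem fun h => hu h.1]

end

variable [Fintype S] [MeasurableSpace S] [MeasurableSingletonClass S] [Finite A]

/-- The step value in a Markovian state, as an integral over the residence time. -/
theorem stepValue_bot (M : MarkovAutomaton S A) (G : Set S) {I : Set ℝ}
    (hI : I.OrdConnected) {W : S → ℝ → ℝ≥0∞} (hW : ∀ s, Measurable (W s)) {s : S} (hs : s ∈ M.MS)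
    (t : ℝ) :
    M.stepValue G I W s t .bot =
      ∫⁻ u in Ici 0, ENNReal.ofReal (M.E s * Real.exp (-(M.E s * u))) *
        ∑ s', ENNReal.ofReal (M.P s s') * stepGain G I W s t (u.toNNReal, s') := by
  have hm : Measurable fun u : ℝ≥0 =>
      ∑ s', ENNReal.ofReal (M.P s s') * stepGain G I W s t (u, s') := by
    refine Finset.measurable_fun_sum _ fun s' _ => Measurable.const_mul ?_ _
    exact measurable_stepGain hI hW measurable_const measurable_const (by fun_prop)
  rw [M.stepValue_eq_sum G hI hW]
  have hn (s' : S) : M.next s .bot s' = ENNReal.ofReal (M.P s s') := by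
    simp only [next, dif_pos hs, PMF.ofFintype_apply]
  simp only [hn, sojourn, if_pos hs]
  rw [lintegral_map hm measurable_real_toNNReal]
  exact lintegral_expMeasure (hm.comp measurable_real_toNNReal)

theorem stepValue_act (M : MarkovAutomaton S A) (G : Set S) {I : Set ℝ}
    (hI : I.OrdConnected) {W : S → ℝ → ℝ≥0∞} (hW : ∀ s, Measurable (W s)) {s : S} {α : A}
    (hα : α ∈ M.Act s) (t : ℝ) :
    M.stepValue G I W s t (.act α) = ∑ s', M.dist s α s' * stepGain G I W s t (0, s') := by
  rw [M.stepValue_eq_sum G hI hW]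
  simp only [sojourn, if_neg (M.notMem_MS_of_mem_Act hα), next]
  rw [lintegral_dirac]

/-- The operator `Ω` takes the best value of a step, at time zero. -/
theorem OmegaFun_eq_iSup (M : MarkovAutomaton S A) (G : Set S) (F : S × TInterval → UnitI)
    (I : TInterval) {W : S → ℝ → ℝ≥0∞} (hW : ∀ s, Measurable (W s))
    (hFW : ∀ s u, 0 ≤ u → shifted F s I u = W s u) (s : S) :
    M.OmegaFun G F s I =
      ⨆ (σ) (_ : M.Enabled s σ), M.stepValue G I.carrier W s 0 σ := by
  unfold OmegaFun
  split_ifs with h1 h2 h3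
  · rw [← M.lintegral_stepGain_of_mem G F I hFW h1 h2, ← M.stepValue_bot G I.ordConnected hW h1]
    refine le_antisymm (le_iSup₂_of_le Label.bot h1 le_rfl) (iSup₂_le fun σ hσ => ?_)
    cases σ with
    | bot => exact le_rfl
    | act α => exact absurd h1 (M.notMem_MS_of_mem_Act hσ)
  · rw [← M.lintegral_stepGain_of_notMem G F I hFW h2, ← M.stepValue_bot G I.ordConnected hW h1]
    refine le_antisymm (le_iSup₂_of_le Label.bot h1 le_rfl) (iSup₂_le fun σ hσ => ?_)
    cases σ with
    | bot => exact le_rfl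
    | act α => exact absurd h1 (M.notMem_MS_of_mem_Act hσ)
  all_goals
    -- A probabilistic state is left at once, so the only time spent there is 0.
    have ht : Touches I.carrier 0 (0 + ((0 : ℝ≥0) : ℝ)) ↔ 0 ∈ I.carrier := by
      simp only [NNReal.coe_zero, add_zero]
      exact ⟨fun ⟨x, hx, h, h'⟩ => le_antisymm h h' ▸ hx, fun h => ⟨0, h, le_rfl, le_rfl⟩⟩
  · have hv (α : A) (hα : α ∈ M.Act s) :
        M.stepValue G I.carrier W s 0 (.act α) = 1 := by
      rw [M.stepValue_act G I.ordConnected hW hα]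
      simp only [stepGain, ht, h3, and_self, if_true, mul_one]
      rw [← PMF.tsum_coe (M.dist s α), tsum_fintype]
    refine le_antisymm ?_ (iSup₂_le fun σ hσ => ?_)
    · obtain ⟨α, hα⟩ : (M.Act s).Nonempty := not_not.1 h1
      exact le_iSup₂_of_le (Label.act α) hα (hv α hα).ge
    · cases σ with
      | bot => exact absurd hσ h1
      | act α => exact (hv α hσ).le
  · have hv (α : A) (hα : α ∈ M.Act s) :
        M.stepValue G I.carrier W s 0 (.act α) =
          ∑ s', M.dist s α s' * (F (s', I)).1 := by
      rw [M.stepValue_act G I.ordConnected hW hα]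
      simp only [stepGain, ht, h3, if_false, ← shifted_zero, hFW _ 0 le_rfl]
      simp
    refine le_antisymm (iSup₂_le fun α hα => ?_) (iSup₂_le fun σ hσ => ?_)
    · exact le_iSup₂_of_le (Label.act α) hα (hv α hα).ge
    · cases σ with
      | bot => exact absurd hσ h1
      | act α => exact (hv α hσ).le.trans (le_iSup₂_of_le α hσ le_rfl)

/-- Shifting by t and then by u is shifting by t + u, so a step for I ⊖ t at time 0 is a step for I
at time t. With I fixed, measurability and the inductions along paths involve only the real variable
t. -/
theorem shifted_Omega (M : MarkovAutomaton S A) (G : Set S) (F : S × TInterval → UnitI)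
    (I : TInterval) (hF : ∀ s, Measurable (shifted F s I)) (s : S) (t : ℝ) :
    shifted (M.Omega G F) s I t =
      ⨆ (σ) (_ : M.Enabled s σ), M.stepValue G I.carrier (fun s' => shifted F s' I) s t σ := by
  by_cases h : (ominus I.carrier t).Nonempty
  · have e : shifted (M.Omega G F) s I t = M.OmegaFun G F s (I.shift t h) := by
      unfold shifted
      rw [dif_pos h]
      rfl
    -- This W is measurable by `hF`, and agrees with the values for the shifted interval where u ≥
    -- 0, which is all that residence times need.
    rw [e, M.OmegaFun_eq_iSup G F (I.shift t h) (W := fun s' u => shifted F s' I (t + u))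
      (fun s' => (hF s').comp (by fun_prop)) fun s' u hu => shifted_shift F s' I t h hu]
    refine iSup_congr fun σ => iSup_congr fun _ => lintegral_congr fun p => ?_
    have hT : Touches (I.shift t h).carrier 0 (0 + p.1) ↔ Touches I.carrier t (t + p.1) := by
      rw [zero_add]
      exact touches_ominus I.carrier t p.1
    by_cases hp : s ∈ G ∧ Touches I.carrier t (t + p.1)
    · rw [stepGain_of_touches hp, stepGain_of_touches ⟨hp.1, hT.2 hp.2⟩]
    · rw [stepGain_of_not_touches hp, stepGain_of_not_touches fun hq => hp ⟨hq.1, hT.1 hq.2⟩,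
        zero_add]
  -- Once I ⊖ t is empty, no later stay meets I and all later shifts are empty too, so both sides
  -- vanish.
  · rw [shifted_of_empty _ _ _ h]
    symm
    simp only [ENNReal.iSup_eq_zero]
    intro σ _
    have h0 (p : ℝ≥0 × S) :
        stepGain G I.carrier (fun s' => shifted F s' I) s t p = 0 := by
      have hT : ¬ Touches I.carrier t (t + p.1) := by
        rintro ⟨x, hx, h1, -⟩
        exact h ⟨_, x, hx, h1, rfl⟩
      have hE : ¬ (ominus I.carrier (t + p.1)).Nonempty := by
        rintro ⟨_, x, hx, h1, rfl⟩
        exact h ⟨_, x, hx, le_trans (by simp) h1, rfl⟩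
      simp only [stepGain, hT, and_false, if_false, shifted_of_empty _ _ _ hE]
    simp [stepValue, h0]

end MarkovAutomaton

/-! ### Finite paths and visits within boundedly many states -/

/-- A finite path, continued by repeating its last entry. -/
def FinPath.extend {S A : Type*} {n : ℕ} (h : FinPath S A n) : MAPath S A :=
  fun i => h ⟨min i n, Finset.mem_Iic.2 (min_le_right i n)⟩

/-- The total residence time of a finite path. -/
noncomputable def FinPath.elapsed {S A : Type*} {n : ℕ} (h : FinPath S A n) : ℝ := h.extend.time n

/-- The path occupies some state of `G` within `I` by its `n`-th state. -/
def Hits {S A : Type*} (G : Set S) (I : Set ℝ) (n : ℕ) (π : MAPath S A) : Prop :=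
  (π n).2.2 ∈ G ∧ Touches I (π.time n) (π.time (n + 1))

/-- The paths that visit `G` within `I` by one of their states with index in `[k, N)`. -/
def reachBetween {S : Type*} (A : Type*) (G : Set S) (I : Set ℝ) (k N : ℕ) : Set (MAPath S A) :=
  {π | ∃ j, k ≤ j ∧ j < N ∧ Hits G I j π}

section

variable {S A : Type*}

theorem MAPath.time_succ (π : MAPath S A) (n : ℕ) :
    π.time (n + 1) = π.time n + ((π (n + 1)).2.1 : ℝ) := by
  unfold MAPath.time
  rw [Finset.sum_range_succ]

theorem MAPath.time_congr {π π' : MAPath S A} {n : ℕ} (h : ∀ i ≤ n, π i = π' i) :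
    π.time n = π'.time n := by
  unfold MAPath.time
  refine Finset.sum_congr rfl fun i hi => ?_
  rw [h (i + 1) (Finset.mem_range.1 hi)]

/-- The residence time in the n-th state is recorded in entry n + 1, hence the bound n + 1. -/
theorem hits_congr {G : Set S} {I : Set ℝ} {π π' : MAPath S A} {n : ℕ}
    (h : ∀ i ≤ n + 1, π i = π' i) : Hits G I n π ↔ Hits G I n π' := by
  unfold Hits
  rw [h n n.le_succ, MAPath.time_congr h, MAPath.time_congr fun i hi => h i (hi.trans n.le_succ)]

theorem FinPath.extend_frestrictLe (π : MAPath S A) {n i : ℕ} (hi : i ≤ n) :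
    FinPath.extend (Preorder.frestrictLe n π : FinPath S A n) i = π i := by
  simp [FinPath.extend, hi]

theorem FinPath.last_frestrictLe (π : MAPath S A) (n : ℕ) :
    FinPath.last (Preorder.frestrictLe n π : FinPath S A n) = (π n).2.2 := rfl

theorem FinPath.elapsed_frestrictLe (π : MAPath S A) (n : ℕ) :
    FinPath.elapsed (Preorder.frestrictLe n π : FinPath S A n) = π.time n :=
  MAPath.time_congr fun _ hi => FinPath.extend_frestrictLe π hi

theorem reachBetween_succ (G : Set S) (I : Set ℝ) {k N : ℕ} (h : k < N) :
    reachBetween A G I k N = {π | Hits G I k π ∨ π ∈ reachBetween A G I (k + 1) N} := by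
  ext π
  constructor
  · rintro ⟨j, h1, h2, h3⟩
    rcases h1.eq_or_lt with rfl | h1
    · exact Or.inl h3
    · exact Or.inr ⟨j, h1, h2, h3⟩
  · rintro (h3 | ⟨j, h1, h2, h3⟩)
    · exact ⟨k, le_rfl, h, h3⟩
    · exact ⟨j, (Nat.le_succ k).trans h1, h2, h3⟩

theorem reachBetween_self (G : Set S) (I : Set ℝ) (N : ℕ) : reachBetween A G I N N = ∅ := by
  ext π
  simp only [mem_empty_iff_false, iff_false]
  rintro ⟨j, h1, h2, -⟩
  omega

theorem reach_eq_iUnion (G : Set S) (I : Set ℝ) : reach A G I = ⋃ N, reachBetween A G I 0 N := by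
  ext π
  simp only [mem_iUnion]
  constructor
  · rintro ⟨t, ht, s, hs, n, rfl, h1, h2⟩
    exact ⟨n + 1, n, Nat.zero_le n, n.lt_succ_self, hs, t, ht, h1, h2⟩
  · rintro ⟨N, n, -, -, hs, t, ht, h1, h2⟩
    exact ⟨t, ht, (π n).2.2, hs, n, rfl, h1, h2⟩

theorem monotone_reachBetween (G : Set S) (I : Set ℝ) : Monotone (reachBetween A G I 0) :=
  fun _ _ h _ ⟨j, h1, h2, h3⟩ => ⟨j, h1, h2.trans_le h, h3⟩

variable [MeasurableSpace S]

theorem MAPath.measurable_time (n : ℕ) : Measurable fun π : MAPath S A => π.time n := by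
  unfold MAPath.time
  fun_prop

theorem FinPath.measurable_extend (n : ℕ) : Measurable (FinPath.extend : FinPath S A n → _) := by
  unfold FinPath.extend
  fun_prop

theorem FinPath.measurable_elapsed (n : ℕ) : Measurable (FinPath.elapsed : FinPath S A n → ℝ) :=
  (MAPath.measurable_time n).comp (FinPath.measurable_extend n)

theorem FinPath.measurable_last (n : ℕ) : Measurable (FinPath.last : FinPath S A n → S) := by
  unfold FinPath.last
  fun_prop

variable [Finite S] [MeasurableSingletonClass S]

theorem measurableSet_hits (G : Set S) {I : Set ℝ} (hI : I.OrdConnected) (n : ℕ) :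
    MeasurableSet {π : MAPath S A | Hits G I n π} := by
  have h : Measurable fun π : MAPath S A => (π n).2.2 := by fun_prop
  refine (h (MeasurableSet.of_discrete (s := G))).inter (measurableSet_touches hI
    (MAPath.measurable_time n) (MAPath.measurable_time (n + 1)) fun π => ?_)
  rw [MAPath.time_succ]
  simp

theorem measurableSet_reachBetween (G : Set S) {I : Set ℝ} (hI : I.OrdConnected) (k N : ℕ) :
    MeasurableSet (reachBetween A G I k N) := by
  have : reachBetween A G I k N = ⋃ j, ⋃ (_ : k ≤ j), ⋃ (_ : j < N), {π | Hits G I j π} := by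
    ext π
    simp only [reachBetween, mem_iUnion, mem_ofPred_eq, exists_prop]
  rw [this]
  exact MeasurableSet.iUnion fun j => MeasurableSet.iUnion fun _ => MeasurableSet.iUnion fun _ =>
    measurableSet_hits G hI j

end

/-! ### Conditioning the path law on one more step -/

/-- An integral over one step of a trajectory, when the integrand depends only on the new point. -/
theorem lintegral_partialTraj_eq_of_forall {X : ℕ → Type*} [∀ n, MeasurableSpace (X n)]
    (κ : (n : ℕ) → Kernel ((i : Finset.Iic n) → X i) (X (n + 1))) [∀ n, IsMarkovKernel (κ n)]
    {k : ℕ} (h : (i : Finset.Iic k) → X i) {f : ((i : Finset.Iic (k + 1)) → X i) → ℝ≥0∞}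
    {g : X (k + 1) → ℝ≥0∞} (hf : Measurable f) (hg : Measurable g)
    (hfg : ∀ π : (n : ℕ) → X n, Preorder.frestrictLe k π = h →
      f (Preorder.frestrictLe (k + 1) π) = g (π (k + 1))) :
    ∫⁻ y, f y ∂(Kernel.partialTraj κ k (k + 1) h) = ∫⁻ e, g e ∂(κ k h) := by
  have hmap : (Kernel.traj κ k h).map (fun x => x (k + 1)) = κ k h := by
    rw [← Kernel.map_apply _ (by fun_prop), Kernel.map_traj_succ_self]
  rw [← hmap, lintegral_map hg (by fun_prop), ← Kernel.traj_map_frestrictLe_apply,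
    lintegral_map hf (Preorder.measurable_frestrictLe (k + 1))]
  -- Both integrals are now over trajectories from h; `Kernel.lintegral_traj` overwrites the prefix
  -- by h, so that `hfg` applies to every path and not just almost every one.
  refine (Kernel.lintegral_traj h (hf.comp (Preorder.measurable_frestrictLe (k + 1)))).trans
    (Eq.trans (lintegral_congr fun x => hfg _ ?_)
      (Kernel.lintegral_traj h (hg.comp (measurable_pi_apply (k + 1)))).symm)
  ext1 i
  simp [Function.updateFinset]

namespace MarkovAutomaton

variable {S A : Type*} [Fintype S] [MeasurableSpace S] [MeasurableSingletonClass S] [Finite A]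

/-- The law of the whole path under the policy `D`, given its first `k` steps. -/
noncomputable def condLaw (M : MarkovAutomaton S A) (D : M.Policy) (k : ℕ) (h : FinPath S A k) :
    Measure (MAPath S A) :=
  Kernel.traj (X := fun _ => Entry S A) (fun n => M.step D n) k h

open Classical in
/-- First-step decomposition of the reachability probability. -/
theorem condLaw_reachBetween (M : MarkovAutomaton S A) (D : M.Policy) (G : Set S) {I : Set ℝ}
    (hI : I.OrdConnected) {k N : ℕ} (hkN : k < N) (h : FinPath S A k) :
    M.condLaw D k h (reachBetween A G I k N) =
      ∫⁻ y, (if Hits G I k (FinPath.extend y) then 1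
        else M.condLaw D (k + 1) y (reachBetween A G I (k + 1) N))
          ∂(Kernel.partialTraj (X := fun _ => Entry S A) (fun n => M.step D n) k (k + 1) h) := by
  set κ : (n : ℕ) → Kernel (FinPath S A n) (Entry S A) := fun n => M.step D n
  have hm := measurableSet_reachBetween (A := A) G hI (k + 1) N
  -- The visit by the k-th state is read off the prefix, the later visits off the whole path. Given
  -- the prefix, the former is decided, and the disintegration of the path law applies to B.
  let B : Set (FinPath S A (k + 1) × MAPath S A) :=
    {p | Hits G I k p.1.extend ∨ p.2 ∈ reachBetween A G I (k + 1) N}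
  have hB : MeasurableSet B := by
    refine MeasurableSet.union ?_ (measurable_snd hm)
    exact ((FinPath.measurable_extend _).comp measurable_fst) (measurableSet_hits G hI k)
  have hpre : reachBetween A G I k N =
      (fun x : MAPath S A => ((Preorder.frestrictLe (k + 1) x : FinPath S A (k + 1)), x)) ⁻¹' B := by
    rw [reachBetween_succ G I hkN]
    ext π
    have : Hits G I k (FinPath.extend (Preorder.frestrictLe (k + 1) π : FinPath S A (k + 1))) ↔
        Hits G I k π := hits_congr fun i hi => FinPath.extend_frestrictLe π hi
    exact or_congr this.symm Iff.rfl
  have key := Kernel.partialTraj_compProd_traj (X := fun _ => Entry S A) (κ := κ)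
    (Nat.le_succ k) h
  have hmeas : Measurable fun x : MAPath S A =>
      ((Preorder.frestrictLe (k + 1) x : FinPath S A (k + 1)), x) :=
    (Preorder.measurable_frestrictLe (k + 1)).prodMk measurable_id
  unfold condLaw
  rw [hpre, ← Measure.map_apply hmeas hB]
  refine (congrArg (fun μ => μ B) key.symm).trans ?_
  rw [Measure.compProd_apply hB]
  refine lintegral_congr fun y => ?_
  split_ifs with hy
  · have : Prod.mk y ⁻¹' B = univ := eq_univ_of_forall fun x => Or.inl hy
    rw [this]
    exact measure_univ
  · congr 1
    ext x
    exact or_iff_right hy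

-- Given h, the integrand depends only on the new entry, whose law is the policy's label followed by
-- `stepLaw`. The policy thus enters the recursion only as an average of `stepValue` over labels.
open Classical in
theorem lintegral_partialTraj_succ (M : MarkovAutomaton S A) (D : M.Policy) (G : Set S) {I : Set ℝ}
    (hI : I.OrdConnected) {W : S → ℝ → ℝ≥0∞} (hW : ∀ s, Measurable (W s)) (k : ℕ)
    (h : FinPath S A k) :
    ∫⁻ y : FinPath S A (k + 1), (if Hits G I k y.extend then 1 else W y.last y.elapsed)
        ∂(Kernel.partialTraj (X := fun _ => Entry S A) (fun n => M.step D n) k (k + 1) h) =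
      ∫⁻ σ, M.stepValue G I W h.last h.elapsed σ ∂D.choice k h := by
  have := D.isMarkov k
  have hg : Measurable fun e : Entry S A => stepGain G I W h.last h.elapsed e.2 :=
    measurable_stepGain hI hW measurable_const measurable_const measurable_snd
  have hf : Measurable fun y : FinPath S A (k + 1) =>
      if Hits G I k y.extend then 1 else W y.last y.elapsed := by
    refine Measurable.ite ((FinPath.measurable_extend _) (measurableSet_hits G hI k))
      measurable_const ?_
    exact (measurable_from_prod_countable_right (f := fun q : S × ℝ => W q.1 q.2) hW).comp
      ((FinPath.measurable_last _).prodMk (FinPath.measurable_elapsed _))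
  have hstep : ∫⁻ σ, M.stepValue G I W h.last h.elapsed σ ∂D.choice k h =
      ∫⁻ e, stepGain G I W h.last h.elapsed e.2 ∂(M.step D k h) := by
    unfold step
    rw [Kernel.lintegral_compProd _ _ _ hg]
    rfl
  rw [hstep]
  refine lintegral_partialTraj_eq_of_forall (X := fun _ => Entry S A) _ h hf hg
    fun (π : MAPath S A) hr => ?_
  have h1 : h.last = (π k).2.2 := by rw [← hr, FinPath.last_frestrictLe]
  have h2 : h.elapsed = π.time k := by rw [← hr, FinPath.elapsed_frestrictLe]
  have h3 : Hits G I k (FinPath.extend (Preorder.frestrictLe (k + 1) π : FinPath S A (k + 1))) ↔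
      Hits G I k π := hits_congr fun i hi => FinPath.extend_frestrictLe π hi
  have h4 : Hits G I k π ↔ h.last ∈ G ∧
      Touches I h.elapsed (h.elapsed + (((π (k + 1)).2.1 : ℝ≥0) : ℝ)) := by
    rw [h1, h2, ← MAPath.time_succ, Hits]
  by_cases hH : Hits G I k π
  · rw [if_pos (h3.2 hH), stepGain_of_touches (h4.1 hH)]
  · rw [if_neg (mt h3.1 hH), stepGain_of_not_touches (mt h4.2 hH), FinPath.last_frestrictLe,
      FinPath.elapsed_frestrictLe, MAPath.time_succ, h2]

end MarkovAutomaton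

/-! ### Iterates of Ω as optimal values for finite horizons -/

namespace MarkovAutomaton

variable {S A : Type*}

theorem exists_enabled (M : MarkovAutomaton S A) (s : S) : ∃ σ, M.Enabled s σ := by
  by_cases h : s ∈ M.MS
  · exact ⟨.bot, h⟩
  · obtain ⟨α, hα⟩ : (M.Act s).Nonempty := not_not.1 h
    exact ⟨.act α, hα⟩

theorem shifted_iSup {F : S × TInterval → UnitI} {f : ℕ → S × TInterval → UnitI}
    (h : ∀ x, (F x).1 = ⨆ n, (f n x).1) (s : S) (I : TInterval) (t : ℝ) :
    shifted F s I t = ⨆ n, shifted (f n) s I t := by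
  unfold shifted
  split_ifs
  · exact h _
  · simp

variable [Fintype S]

/-- The iterates of `Ω`, started from the zero function. -/
noncomputable def iter (M : MarkovAutomaton S A) (G : Set S) (n : ℕ) : S × TInterval → UnitI :=
  (M.Omega G)^[n] fun _ => ⟨0, le_rfl, zero_le_one⟩

theorem iter_succ (M : MarkovAutomaton S A) (G : Set S) (n : ℕ) :
    M.iter G (n + 1) = M.Omega G (M.iter G n) :=
  Function.iterate_succ_apply' _ _ _

theorem shifted_iter_zero (M : MarkovAutomaton S A) (G : Set S) (s : S) (I : TInterval) (t : ℝ) :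
    shifted (M.iter G 0) s I t = 0 := by
  unfold shifted
  split_ifs <;> rfl

theorem monotone_iter (M : MarkovAutomaton S A) (G : Set S) : Monotone (M.iter G) :=
  (M.Omega_mono G).monotone_iterate_of_le_map fun _ => Subtype.coe_le_coe.1 zero_le

/-- Only monotonicity of Ω is used, and lower integrals are monotone, so F may be non-measurable. -/
theorem iter_le (M : MarkovAutomaton S A) (G : Set S) {F : S × TInterval → UnitI}
    (hF : M.Omega G F = F) (n : ℕ) : M.iter G n ≤ F := by
  induction n with
  | zero => exact fun _ => Subtype.coe_le_coe.1 zero_le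
  | succ n ih =>
    rw [iter_succ, ← hF]
    exact M.Omega_mono G ih

/-- `Ω` commutes with suprema of increasing sequences of measurable functions. -/
theorem OmegaFun_iSup (M : MarkovAutomaton S A) (G : Set S) {F : S × TInterval → UnitI}
    {f : ℕ → S × TInterval → UnitI} (hf : Monotone f) (h : ∀ x, (F x).1 = ⨆ n, (f n x).1)
    (hm : ∀ n s I, Measurable (shifted (f n) s I)) (s : S) (I : TInterval) :
    M.OmegaFun G F s I = ⨆ n, M.OmegaFun G (f n) s I := by
  have hflow (c : ℝ) : M.flow F s I c = ⨆ n, M.flow (f n) s I c := by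
    unfold flow
    -- Monotone convergence: this is where measurability of the approximants is needed.
    rw [← lintegral_iSup]
    · refine lintegral_congr fun t => ?_
      rw [← ENNReal.mul_iSup, ← ENNReal.finsetSum_iSup_of_monotone]
      · simp only [shifted_iSup h, ENNReal.mul_iSup]
      · intro s' n m hnm
        dsimp only
        gcongr
        exact shifted_mono (hf hnm) _ _ _
    · intro n
      refine Measurable.mul (by fun_prop) (Finset.measurable_fun_sum _ fun s' _ => ?_)
      exact (hm n s' I).const_mul _
    · intro n m hnm t
      dsimp only
      gcongr
      exact shifted_mono (hf hnm) _ _ _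
  unfold OmegaFun
  split_ifs
  · rw [hflow, ENNReal.add_iSup]
  · exact hflow _
  · simp
  · rw [iSup_comm]
    refine iSup_congr fun α => ?_
    rw [iSup_comm]
    refine iSup_congr fun _ => ?_
    rw [← ENNReal.finsetSum_iSup_of_monotone]
    · simp only [h, ENNReal.mul_iSup]
    · intro s' n m hnm
      dsimp only
      gcongr
      exact hf hnm _

variable [MeasurableSpace S] [MeasurableSingletonClass S] [Finite A]

theorem measurable_shifted_iter (M : MarkovAutomaton S A) (G : Set S) (n : ℕ) (s : S)
    (I : TInterval) : Measurable (shifted (M.iter G n) s I) := by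
  induction n generalizing s with
  | zero =>
    rw [show shifted (M.iter G 0) s I = fun _ => 0 from funext (M.shifted_iter_zero G s I)]
    exact measurable_const
  | succ n ih =>
    rw [show shifted (M.iter G (n + 1)) s I = _ from funext fun t => by
      rw [iter_succ, M.shifted_Omega G _ I ih]]
    refine Measurable.iSup fun σ => Measurable.iSup fun _ => ?_
    exact M.measurable_stepValue G I.ordConnected ih s σ

/-- Under every policy, the probability of a visit within the next `n` states is at most the
`n`-th iterate of `Ω`. -/
theorem condLaw_reachBetween_le (M : MarkovAutomaton S A) (D : M.Policy) (G : Set S)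
    (I : TInterval) (n k : ℕ) (h : FinPath S A k) :
    M.condLaw D k h (reachBetween A G I.carrier k (k + n)) ≤
      shifted (M.iter G n) h.last I h.elapsed := by
  classical
  induction n generalizing k with
  | zero => simp [reachBetween_self]
  | succ n ih =>
    have := D.isMarkov k
    rw [M.condLaw_reachBetween D G I.ordConnected (by omega), iter_succ,
      M.shifted_Omega G _ I fun s => M.measurable_shifted_iter G n s I]
    calc _ ≤ ∫⁻ y : FinPath S A (k + 1), (if Hits G I.carrier k y.extend then 1 else
            shifted (M.iter G n) y.last I y.elapsed)
            ∂(Kernel.partialTraj (X := fun _ => Entry S A) (fun n => M.step D n) k (k + 1) h) := by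
          refine lintegral_mono fun y => ?_
          dsimp only
          split_ifs
          · exact le_rfl
          · rw [show k + (n + 1) = k + 1 + n by omega]
            exact ih (k + 1) y
      _ = ∫⁻ σ, M.stepValue G I.carrier (fun s => shifted (M.iter G n) s I) h.last h.elapsed σ
            ∂D.choice k h :=
          M.lintegral_partialTraj_succ D G I.ordConnected
            (fun s => M.measurable_shifted_iter G n s I) k h
      _ ≤ ∫⁻ _, (⨆ (σ) (_ : M.Enabled h.last σ), M.stepValue G I.carrier
            (fun s => shifted (M.iter G n) s I) h.last h.elapsed σ) ∂D.choice k h := by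
          -- The policy gives positive mass only to enabled labels, and there are countably many
          -- labels.
          refine lintegral_mono_ae ((ae_iff_of_countable).2 fun σ hσ => ?_)
          exact le_iSup₂_of_le σ (D.enabled k h σ hσ) le_rfl
      _ = _ := by rw [lintegral_const, measure_univ, mul_one]

/-- A measurable choice of the best label, for a given value of the continuation. -/
theorem exists_measurable_best_label (M : MarkovAutomaton S A) (G : Set S) {I : Set ℝ}
    (hI : I.OrdConnected) {W : S → ℝ → ℝ≥0∞} (hW : ∀ s, Measurable (W s)) :
    ∃ g : S → ℝ → Label A, (∀ s, Measurable (g s)) ∧ ∀ s t, M.Enabled s (g s t) ∧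
      M.stepValue G I W s t (g s t) = ⨆ (σ) (_ : M.Enabled s σ), M.stepValue G I W s t σ := by
  classical
  have (s : S) : ∃ g : ℝ → Label A, Measurable g ∧ ∀ t, M.Enabled s (g t) ∧
      M.stepValue G I W s t (g t) = ⨆ (σ) (_ : M.Enabled s σ), M.stepValue G I W s t σ := by
    obtain ⟨σ₀, h₀⟩ := M.exists_enabled s
    have hfin : {σ | M.Enabled s σ}.Finite := toFinite _
    obtain ⟨g, hg, h⟩ := exists_measurable_argmax (fun σ t => M.stepValue G I W s t σ)
      (fun σ => M.measurable_stepValue G hI hW s σ) hfin.toFinset ⟨σ₀, by simpa using h₀⟩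
    have hen (t : ℝ) : M.Enabled s (g t) := by simpa using (h t).1
    refine ⟨g, hg, fun t => ⟨hen t, le_antisymm (le_iSup₂_of_le (g t) (hen t) le_rfl) ?_⟩⟩
    exact iSup₂_le fun σ hσ => (h t).2 σ (by simpa using hσ)
  choose g hg using this
  exact ⟨g, fun s => (hg s).1, fun s => (hg s).2⟩

/-- For every horizon there is an optimal policy. -/
theorem exists_policy_eq_iter (M : MarkovAutomaton S A) (G : Set S) (I : TInterval) (N : ℕ) :
    ∃ D : M.Policy, ∀ n k (h : FinPath S A k), k + n = N →
      M.condLaw D k h (reachBetween A G I.carrier k N) =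
        shifted (M.iter G n) h.last I h.elapsed := by
  classical
  have hm (n : ℕ) (s : S) := M.measurable_shifted_iter G n s I
  choose g hg hen hbest using fun n =>
    M.exists_measurable_best_label G I.ordConnected (hm n)
  -- With N - k states left to examine, the step from state k uses up one, so the label is optimal
  -- against the iterate N - k - 1. For k ≥ N the choice does not matter.
  have hf (k : ℕ) : Measurable fun h : FinPath S A k => g (N - k - 1) h.last h.elapsed :=
    (measurable_from_prod_countable_right (f := fun q : S × ℝ => g (N - k - 1) q.1 q.2)
      (hg _)).comp ((FinPath.measurable_last k).prodMk (FinPath.measurable_elapsed k))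
  let D : M.Policy :=
    { choice := fun k => Kernel.deterministic _ (hf k)
      isMarkov := fun k => inferInstance
      enabled := fun k h σ hσ => by
        rw [Kernel.deterministic_apply, Measure.dirac_apply] at hσ
        have : g (N - k - 1) h.last h.elapsed = σ := by
          by_contra hne
          exact hσ (indicator_of_notMem (by simpa using hne) _)
        exact this ▸ hen _ _ _ }
  refine ⟨D, fun n => ?_⟩
  induction n with
  | zero =>
    rintro k h rfl
    simp [reachBetween_self, shifted_iter_zero]
  | succ n ih =>
    intro k h hk
    rw [M.condLaw_reachBetween D G I.ordConnected (by omega), iter_succ,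
      M.shifted_Omega G _ I (hm n), ← hbest n]
    have ih' (y : FinPath S A (k + 1)) := ih (k + 1) y (by omega)
    simp only [ih']
    rw [M.lintegral_partialTraj_succ D G I.ordConnected (hm n) k h]
    change ∫⁻ σ, _ ∂(Kernel.deterministic _ (hf k) h) = _
    rw [Kernel.lintegral_deterministic, show N - k - 1 = n by omega]

/-- Every visit occurs at a finite index, so reachability is the increasing union of its bounded
versions, and the suprema over policies and horizons are exchanged. The optimal policy may vary with
the horizon. -/
theorem pmax_eq_iSup_iter (M : MarkovAutomaton S A) (G : Set S) (x : S × TInterval) :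
    (M.pmax G x).1 = ⨆ n, (M.iter G n x).1 := by
  obtain ⟨s, I⟩ := x
  have hlast : FinPath.last (n := 0) (fun _ => ((Label.bot, 0, s) : Entry S A)) = s := rfl
  have helapsed : FinPath.elapsed (n := 0) (fun _ => ((Label.bot, 0, s) : Entry S A)) = 0 := by
    simp [FinPath.elapsed, MAPath.time]
  refine le_antisymm (iSup_le fun D => ?_) (iSup_le fun n => ?_)
  · change M.Pr D s (reach A G I.carrier) ≤ _
    rw [reach_eq_iUnion, (monotone_reachBetween G I.carrier).measure_iUnion]
    refine iSup_mono fun n => ?_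
    have := M.condLaw_reachBetween_le D G I n 0 (fun _ => (Label.bot, 0, s))
    rwa [hlast, helapsed, shifted_zero, zero_add] at this
  · obtain ⟨D, hD⟩ := M.exists_policy_eq_iter G I n
    have := hD n 0 (fun _ => (Label.bot, 0, s)) (zero_add n)
    rw [hlast, helapsed, shifted_zero] at this
    rw [← this]
    refine le_iSup_of_le (f := fun D : M.Policy => M.Pr D s (reach A G I.carrier)) D ?_
    rw [reach_eq_iUnion]
    exact measure_mono (subset_iUnion (reachBetween A G I.carrier 0) n)

end MarkovAutomaton

/-! ### The least fixpoint theorem -/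

/-- The maximal timed reachability probability is the least fixpoint of `Ω`, among all functions
`S × ℐ → [0,1]`.  It is measurable in the time shift, so that the integrals in its fixpoint
equation are integrals of measurable functions; for other functions they are lower integrals. -/
theorem lemma5p1 {S A : Type*} [Fintype S] [MeasurableSpace S] [MeasurableSingletonClass S]
    [Finite A] (M : MarkovAutomaton S A) (G : Set S) :
    (∀ s I, Measurable fun t : ℝ => MarkovAutomaton.shifted (M.pmax G) s I t) ∧
    IsLeast {F : S × TInterval → UnitI | M.Omega G F = F} (M.pmax G) := by
  refine ⟨fun s I => ?_, ?_, fun F hF x => ?_⟩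
  · simp only [MarkovAutomaton.shifted_iSup (M.pmax_eq_iSup_iter G)]
    exact Measurable.iSup fun n => M.measurable_shifted_iter G n s I
  · funext x
    refine Subtype.ext ?_
    change M.OmegaFun G (M.pmax G) x.1 x.2 = (M.pmax G x).1
    rw [M.OmegaFun_iSup G (M.monotone_iter G) (M.pmax_eq_iSup_iter G) (M.measurable_shifted_iter G),
      M.pmax_eq_iSup_iter G x]
    refine le_antisymm (iSup_le fun n => ?_) (iSup_le fun n => ?_)
    · refine le_iSup_of_le (n + 1) ?_
      rw [M.iter_succ]
      exact le_rfl
    · refine le_iSup_of_le n ?_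
      have := M.monotone_iter G n.le_succ x
      rw [Nat.succ_eq_add_one, M.iter_succ] at this
      exact this
  · change (M.pmax G x).1 ≤ (F x).1
    rw [M.pmax_eq_iSup_iter G x]
    exact iSup_le fun n => M.iter_le G hF n x
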